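/- Let $d\ge3$ and $q\ge1$ be integers and let $\beta,B\ge0$ be real. Consider the ferromagnetic $q$-state Potts specification $\psi(\sigma,\sigma')=e^{\beta\mathbf 1\{\sigma=\sigma'\}}$, $\bar\psi(\sigma)=e^{B\mathbf 1\{\sigma=1\}}$ on $[q]=\{1,\dots,q\}$. Let $\Delta$ be the set of probability measures on $[q]$, let $\mathsf{BP}:\Delta\to\Delta$ be the Bethe recursion $$(\mathsf{BP}h)(\sigma)=\frac1{z_h}\,\bar\psi(\sigma)\Big(\sum_{\sigma'}\psi(\sigma,\sigma')h_{\sigma'}\Big)^{d-1},\qquad z_h=\sum_{\sigma}\bar\psi(\sigma)\Big(\sum_{\sigma'}\psi(\sigma,\sigma')h_{\sigma'}\Big)^{d-1},$$ let $\Delta^\star\subset\Delta$ be its set of fixed points, and for $h\in\Delta$ let $$\Phi(h)=\log\Big\{\sum_\sigma\bar\psi(\sigma)\Big(\sum_{\sigma'}\psi(\sigma,\sigma')h_{\sigma'}\Big)^{d}\Big\}-\frac d2\log\Big\{\sum_{\sigma,\sigma'}\psi(\sigma,\sigma')h_\sigma h_{\sigma'}\Big\}.$$ Then the limit $h^{\mathrm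 f}$ of the iterates of $\mathsf{BP}$ started from the uniform measure on $[q]$, and the limit $h^{\mathrm m}$ of the iterates of $\mathsf{BP}$ started from the probability measure supported on spin $1$, exist and belong to $\Delta^\star$; the function $h\mapsto\Phi(h)$ is bounded above on $\Delta^\star$, and $$\Phi\equiv\sup_{h\in\Delta^\star}\Phi(h)=\max\{\Phi(h^{\mathrm f}),\Phi(h^{\mathrm m})\}.$$ If moreover $B>0$, then $\Phi(h)<\max\{\Phi(h^{\mathrm f}),\Phi(h^{\mathrm m})\}$ for every $h\in\Delta^\star\setminus\{h^{\mathrm f},h^{\mathrm m}\}$. -/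

import Mathlib

open Filter Topology

noncomputable section

namespace Bethe

variable {X : Type*} [Fintype X]

/-- Normalizing constant `z_h = ∑_σ ψ̄(σ) (∑_σ' ψ(σ,σ') h_σ')^(d-1)` of the Bethe recursion. -/
def bpNorm (d : ℕ) (ψ : X → X → ℝ) (ψbar : X → ℝ) (h : X → ℝ) : ℝ :=
  ∑ σ, ψbar σ * (∑ σ', ψ σ σ' * h σ') ^ (d - 1)

/-- The belief propagation map (Bethe recursion)
`(BP h)(σ) = z_h⁻¹ ψ̄(σ) (∑_σ' ψ(σ,σ') h_σ')^(d-1)`. -/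
def bp (d : ℕ) (ψ : X → X → ℝ) (ψbar : X → ℝ) (h : X → ℝ) : X → ℝ :=
  fun σ => (bpNorm d ψ ψbar h)⁻¹ * (ψbar σ * (∑ σ', ψ σ σ' * h σ') ^ (d - 1))

/-- The set `Δ*` of fixed points of `BP` in the simplex of probability measures on `X`. -/
def fixedPts (d : ℕ) (ψ : X → X → ℝ) (ψbar : X → ℝ) : Set (X → ℝ) :=
  {h | h ∈ stdSimplex ℝ X ∧ bp d ψ ψbar h = h}

/-- The Bethe free energy functional
`Φ(h) = log ∑_σ ψ̄(σ) (∑_σ' ψ(σ,σ') h_σ')^d - (d/2) log ∑_{σ,σ'} ψ(σ,σ') h_σ h_σ'`. -/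
def functional (d : ℕ) (ψ : X → X → ℝ) (ψbar : X → ℝ) (h : X → ℝ) : ℝ :=
  Real.log (∑ σ, ψbar σ * (∑ σ', ψ σ σ' * h σ') ^ d)
    - (d : ℝ) / 2 * Real.log (∑ σ, ∑ σ', ψ σ σ' * h σ * h σ')

/-- The Bethe prediction `Φ = sup_{h ∈ Δ*} Φ(h)`. -/
def prediction (d : ℕ) (ψ : X → X → ℝ) (ψbar : X → ℝ) : ℝ :=
  sSup (functional d ψ ψbar '' fixedPts d ψ ψbar)

end Bethe

namespace Potts

/-- Edge weight `ψ(σ,σ') = exp (β 1{σ = σ'})` of the `q`-state Potts model. -/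
def edgeWeight (q : ℕ) (β : ℝ) (σ σ' : Fin q) : ℝ :=
  Real.exp (β * if σ = σ' then 1 else 0)

/-- Vertex weight `ψ̄(σ) = exp (B 1{σ = 1})`; the spin called `1` in `{1, …, q}` is
`0 : Fin q`. -/
def vertexWeight (q : ℕ) [NeZero q] (B : ℝ) (σ : Fin q) : ℝ :=
  Real.exp (B * if σ = 0 then 1 else 0)

/-- The Bethe recursion of the Potts model. -/
def bp (d q : ℕ) [NeZero q] (β B : ℝ) : (Fin q → ℝ) → (Fin q → ℝ) :=
  Bethe.bp d (edgeWeight q β) (vertexWeight q B)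

/-- The fixed points `Δ*` of the Potts Bethe recursion. -/
def fixedPts (d q : ℕ) [NeZero q] (β B : ℝ) : Set (Fin q → ℝ) :=
  Bethe.fixedPts d (edgeWeight q β) (vertexWeight q B)

/-- The Bethe free energy functional `h ↦ Φ(h)` of the Potts model. -/
def functional (d q : ℕ) [NeZero q] (β B : ℝ) : (Fin q → ℝ) → ℝ :=
  Bethe.functional d (edgeWeight q β) (vertexWeight q B)

/-- The Potts Bethe prediction `Φ`. -/
def prediction (d q : ℕ) [NeZero q] (β B : ℝ) : ℝ :=
  Bethe.prediction d (edgeWeight q β) (vertexWeight q B)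

/-- The uniform probability measure on the spins. -/
def uniform (q : ℕ) : Fin q → ℝ := fun _ => (q : ℝ)⁻¹

/-- The probability measure supported on spin `1`. -/
def pointMass (q : ℕ) [NeZero q] : Fin q → ℝ := Pi.single 0 1

end Potts

end

/-!
Write `γ = e^β - 1` and `k = d - 1`. On the simplex the field of `h` at `σ` is `1 + γ h σ`, and up to
logarithms the functional compares `∑ ψ̄ (ψ h)^d` with the power `d / 2` of the quadratic form
`⟨h, ψ h⟩`, which is positive definite for `γ > 0`. By strict Cauchy–Schwarz the functional strictly
increases in the direction in which the recursion moves (`hasDerivAt_functional_of_bp_eq`). Hence a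
maximizer over the whole simplex, which exists by compactness, is a fixed point
(`bp_eq_of_isMaxOn`), and it suffices to show that such a maximizer is one of the two limits.

The second-order condition at a maximizer (`exists_le_of_isMaxOn`) allows `1 + γ h σ < k γ h σ` at one
spin `σ` at most. The largest coordinate may be assumed to sit at the favoured spin, and it has to
sit there if `B > 0`, since otherwise swapping two spins would increase the functional. If two other
coordinates of the maximizer differed, the larger one would satisfy the inequality above by strict
convexity (`cavity_lt_of_lt`), and then so would the one at the favoured spin. So the maximizer is
constant off the favoured spin (`eq_of_isMaxOn`) and equals `biased q x` for some `x ∈ [1/q, 1]`.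

On this segment the recursion is an increasing map of `x`, so that the iterates from its two ends,
the uniform measure and the point mass, converge to its least and greatest fixed points. In terms of
the ratio of the two fields, the displacement of the map has the opposite sign to a polynomial that
is concave first and convex afterwards (`ratioPoly_sign`, `biasedStep_sub`). Therefore at a third
fixed point, strictly between those two, the functional is strictly smaller than at one of them
(`functional_lt_max_of_between`).

For `γ = 0` or `q = 1` the recursion is constant on the simplex and there is nothing to compare.
-/

namespace Potts

/-! ### The recursion and the functional in terms of the fields -/

section

variable {k q : ℕ} {β B : ℝ}

/-- The excess `e^β - 1` of the edge weight of two equal spins over that of two different ones. -/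
noncomputable def coupling (β : ℝ) : ℝ := Real.exp β - 1

/-- The field `ψ h` that a vector `h` on the spins produces, written for arbitrary total mass. -/
noncomputable def cavity (β : ℝ) (h : Fin q → ℝ) (σ : Fin q) : ℝ := ∑ τ, h τ + coupling β * h σ

/-- The symmetric bilinear form `⟨g, ψ h⟩` of the edge weight. -/
noncomputable def edgeForm (β : ℝ) (g h : Fin q → ℝ) : ℝ :=
  (∑ σ, g σ) * (∑ σ, h σ) + coupling β * ∑ σ, g σ * h σ

/-- The vertex term `∑ ψ̄ (ψ h)^(k+1)` of the Bethe functional at degree `k + 1`. -/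
noncomputable def vertexSum (k : ℕ) [NeZero q] (β B : ℝ) (h : Fin q → ℝ) : ℝ :=
  ∑ σ, vertexWeight q B σ * cavity β h σ ^ (k + 1)

/-- The normalization `z_h` of the Bethe recursion at degree `k + 1`. -/
noncomputable def bpSum (k : ℕ) [NeZero q] (β B : ℝ) (h : Fin q → ℝ) : ℝ :=
  ∑ σ, vertexWeight q B σ * cavity β h σ ^ k

lemma coupling_nonneg (hβ : 0 ≤ β) : 0 ≤ coupling β := by
  have := Real.add_one_le_exp β
  unfold coupling; linarith

lemma coupling_pos (hβ : 0 < β) : 0 < coupling β := by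
  have := Real.add_one_le_exp β
  unfold coupling; linarith

lemma vertexWeight_pos [NeZero q] (B : ℝ) (σ : Fin q) : 0 < vertexWeight q B σ := Real.exp_pos _

lemma vertexWeight_zero [NeZero q] (B : ℝ) : vertexWeight q B 0 = Real.exp B := by
  simp [vertexWeight]

lemma vertexWeight_of_ne [NeZero q] (B : ℝ) {σ : Fin q} (hσ : σ ≠ 0) : vertexWeight q B σ = 1 := by
  simp [vertexWeight, hσ]

lemma edgeWeight_eq (σ τ : Fin q) :
    edgeWeight q β σ τ = 1 + coupling β * if σ = τ then 1 else 0 := by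
  unfold edgeWeight coupling
  split_ifs <;> simp

lemma sum_edgeWeight_mul (h : Fin q → ℝ) (σ : Fin q) :
    ∑ τ, edgeWeight q β σ τ * h τ = cavity β h σ := by
  simp [edgeWeight_eq, cavity, add_mul, Finset.sum_add_distrib]

lemma edgeForm_comm (g h : Fin q → ℝ) : edgeForm β g h = edgeForm β h g := by
  simp [edgeForm, mul_comm]

lemma sum_mul_cavity (g h : Fin q → ℝ) : ∑ σ, g σ * cavity β h σ = edgeForm β g h := by
  simp only [cavity, edgeForm, mul_add, Finset.sum_add_distrib, ← Finset.sum_mul]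
  rw [Finset.mul_sum Finset.univ (fun σ => g σ * h σ)]
  congr 1
  exact Finset.sum_congr rfl fun σ _ => by ring

lemma sum_sum_edgeWeight (h : Fin q → ℝ) :
    ∑ σ, ∑ τ, edgeWeight q β σ τ * h σ * h τ = edgeForm β h h := by
  rw [← sum_mul_cavity]
  refine Finset.sum_congr rfl fun σ _ => ?_
  rw [← sum_edgeWeight_mul, Finset.mul_sum]
  exact Finset.sum_congr rfl fun τ _ => by ring

lemma functional_eq [NeZero q] (h : Fin q → ℝ) :
    functional (k + 1) q β B h =
      Real.log (vertexSum k β B h) - ((k : ℝ) + 1) / 2 * Real.log (edgeForm β h h) := by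
  simp [functional, Bethe.functional, sum_edgeWeight_mul, sum_sum_edgeWeight, vertexSum]

lemma bp_apply [NeZero q] (h : Fin q → ℝ) (σ : Fin q) :
    bp (k + 1) q β B h σ =
      (bpSum k β B h)⁻¹ * (vertexWeight q B σ * cavity β h σ ^ k) := by
  simp [bp, Bethe.bp, Bethe.bpNorm, sum_edgeWeight_mul, bpSum]

lemma cavity_add_smul (p δ : Fin q → ℝ) (t : ℝ) (σ : Fin q) :
    cavity β (p + t • δ) σ = cavity β p σ + t * cavity β δ σ := by
  simp only [cavity, Pi.add_apply, Pi.smul_apply, smul_eq_mul, Finset.sum_add_distrib,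
    ← Finset.mul_sum]
  ring

lemma cavity_smul (c : ℝ) (h : Fin q → ℝ) (σ : Fin q) :
    cavity β (c • h) σ = c * cavity β h σ := by
  simp only [cavity, Pi.smul_apply, smul_eq_mul, ← Finset.mul_sum]
  ring

lemma edgeForm_add_smul_right (g p δ : Fin q → ℝ) (t : ℝ) :
    edgeForm β g (p + t • δ) = edgeForm β g p + t * edgeForm β g δ := by
  simp only [← sum_mul_cavity, cavity_add_smul, mul_add, Finset.sum_add_distrib, Finset.mul_sum]
  congr 1
  exact Finset.sum_congr rfl fun σ _ => by ring

lemma edgeForm_add_smul_left (p δ g : Fin q → ℝ) (t : ℝ) :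
    edgeForm β (p + t • δ) g = edgeForm β p g + t * edgeForm β δ g := by
  rw [edgeForm_comm, edgeForm_add_smul_right, edgeForm_comm g, edgeForm_comm g]

lemma edgeForm_smul_smul (c : ℝ) (h : Fin q → ℝ) :
    edgeForm β (c • h) (c • h) = c ^ 2 * edgeForm β h h := by
  simp only [edgeForm, Pi.smul_apply, smul_eq_mul, ← Finset.mul_sum]
  have : ∑ σ, c * h σ * (c * h σ) = c ^ 2 * ∑ σ, h σ * h σ := by
    rw [Finset.mul_sum]; exact Finset.sum_congr rfl fun σ _ => by ring
  rw [this]; ring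

section Simplex

variable {h : Fin q → ℝ}

lemma cavity_of_mem (hh : h ∈ stdSimplex ℝ (Fin q)) (σ : Fin q) :
    cavity β h σ = 1 + coupling β * h σ := by
  rw [cavity, hh.2]

lemma cavity_pos (hβ : 0 ≤ β) (hh : h ∈ stdSimplex ℝ (Fin q)) (σ : Fin q) :
    0 < cavity β h σ := by
  rw [cavity_of_mem hh]
  have := mul_nonneg (coupling_nonneg hβ) (hh.1 σ)
  linarith

lemma edgeForm_pos (hβ : 0 ≤ β) {g : Fin q → ℝ} (hg : g ∈ stdSimplex ℝ (Fin q))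
    (hh : h ∈ stdSimplex ℝ (Fin q)) : 0 < edgeForm β g h := by
  rw [edgeForm, hg.2, hh.2]
  have := mul_nonneg (coupling_nonneg hβ)
    (Finset.sum_nonneg fun σ (_ : σ ∈ Finset.univ) => mul_nonneg (hg.1 σ) (hh.1 σ))
  linarith

variable [NeZero q]

lemma bpSum_pos (hβ : 0 ≤ β) (hh : h ∈ stdSimplex ℝ (Fin q)) : 0 < bpSum k β B h :=
  Finset.sum_pos (fun σ _ => mul_pos (vertexWeight_pos B σ) (pow_pos (cavity_pos hβ hh σ) k))
    Finset.univ_nonempty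

lemma vertexSum_pos (hβ : 0 ≤ β) (hh : h ∈ stdSimplex ℝ (Fin q)) : 0 < vertexSum k β B h :=
  Finset.sum_pos (fun σ _ => mul_pos (vertexWeight_pos B σ) (pow_pos (cavity_pos hβ hh σ) (k + 1)))
    Finset.univ_nonempty

lemma bp_pos (hβ : 0 ≤ β) (hh : h ∈ stdSimplex ℝ (Fin q)) (σ : Fin q) :
    0 < bp (k + 1) q β B h σ := by
  rw [bp_apply]
  exact mul_pos (inv_pos.2 (bpSum_pos hβ hh))
    (mul_pos (vertexWeight_pos B σ) (pow_pos (cavity_pos hβ hh σ) k))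

lemma bp_mem (hβ : 0 ≤ β) (hh : h ∈ stdSimplex ℝ (Fin q)) :
    bp (k + 1) q β B h ∈ stdSimplex ℝ (Fin q) := by
  refine ⟨fun σ => (bp_pos hβ hh σ).le, ?_⟩
  simp only [bp_apply, ← Finset.mul_sum]
  exact inv_mul_cancel₀ (bpSum_pos hβ hh).ne'

/-- Pairing the unnormalized recursion with the field of `δ`. -/
lemma sum_vertexWeight_mul_cavity (hβ : 0 ≤ β) (hh : h ∈ stdSimplex ℝ (Fin q)) (δ : Fin q → ℝ) :
    ∑ σ, vertexWeight q B σ * cavity β h σ ^ k * cavity β δ σ =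
      bpSum k β B h * edgeForm β (bp (k + 1) q β B h) δ := by
  rw [← sum_mul_cavity, Finset.mul_sum]
  refine Finset.sum_congr rfl fun σ _ => ?_
  have := (bpSum_pos (k := k) (B := B) hβ hh).ne'
  rw [bp_apply]
  field_simp

lemma vertexSum_eq (hβ : 0 ≤ β) (hh : h ∈ stdSimplex ℝ (Fin q)) :
    vertexSum k β B h = bpSum k β B h * edgeForm β (bp (k + 1) q β B h) h := by
  rw [← sum_vertexWeight_mul_cavity hβ hh]
  exact Finset.sum_congr rfl fun σ _ => by ring

end Simplex

lemma hasDerivAt_edgeForm (p δ : Fin q → ℝ) (t : ℝ) :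
    HasDerivAt (fun s : ℝ => edgeForm β (p + s • δ) (p + s • δ))
      (2 * edgeForm β (p + t • δ) δ) t := by
  have e : (fun s : ℝ => edgeForm β (p + s • δ) (p + s • δ)) = fun s : ℝ =>
      edgeForm β p p + s * (2 * edgeForm β p δ) + s ^ 2 * edgeForm β δ δ := by
    funext s
    rw [edgeForm_add_smul_right, edgeForm_add_smul_left, edgeForm_add_smul_left,
      edgeForm_comm δ p]
    ring
  rw [e, edgeForm_add_smul_left]
  have h1 := ((hasDerivAt_id t).mul_const (2 * edgeForm β p δ)).const_add (edgeForm β p p)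
  have h2 := ((hasDerivAt_id t).fun_pow 2).mul_const (edgeForm β δ δ)
  refine (h1.add h2).congr_deriv ?_
  simp
  ring

/-- Strict Cauchy–Schwarz inequality for the positive definite form `edgeForm`, in the form of a
positive Gram determinant. -/
lemma gram_pos (hβ : 0 < β) {h δ : Fin q → ℝ} (hh : h ∈ stdSimplex ℝ (Fin q))
    (hδ : ∑ σ, δ σ = 0) (hδ0 : δ ≠ 0) :
    0 < edgeForm β δ δ * edgeForm β h h - edgeForm β h δ ^ 2 := by
  have hγ := coupling_pos hβ
  have cs := Finset.sum_mul_sq_le_sq_mul_sq Finset.univ h δ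
  have hpos : 0 < ∑ σ, δ σ ^ 2 := by
    obtain ⟨σ, hσ⟩ := Function.ne_iff.1 hδ0
    exact Finset.sum_pos' (fun _ _ => sq_nonneg _) ⟨σ, Finset.mem_univ _, by
      have : δ σ ≠ 0 := hσ
      positivity⟩
  simp only [edgeForm, hδ, hh.2, ← sq]
  have : 0 ≤ coupling β ^ 2 *
      ((∑ σ, h σ ^ 2) * (∑ σ, δ σ ^ 2) - (∑ σ, h σ * δ σ) ^ 2) :=
    mul_nonneg (sq_nonneg _) (sub_nonneg.2 cs)
  nlinarith [mul_pos hγ hpos]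

variable [NeZero q]

lemma hasDerivAt_vertexSum (p δ : Fin q → ℝ) (t : ℝ) :
    HasDerivAt (fun s : ℝ => vertexSum k β B (p + s • δ))
      (((k : ℝ) + 1) *
        ∑ σ, vertexWeight q B σ * cavity β (p + t • δ) σ ^ k * cavity β δ σ) t := by
  unfold vertexSum
  simp only [cavity_add_smul]
  rw [Finset.mul_sum]
  refine HasDerivAt.fun_sum fun σ _ => ?_
  have h1 : HasDerivAt (fun s : ℝ => cavity β p σ + s * cavity β δ σ) (cavity β δ σ) t := by
    simpa using ((hasDerivAt_id t).mul_const (cavity β δ σ)).const_add (cavity β p σ)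
  have h2 := (h1.fun_pow (k + 1)).const_mul (vertexWeight q B σ)
  refine h2.congr_deriv ?_
  simp only [Nat.cast_add, Nat.cast_one, Nat.add_sub_cancel]
  ring

lemma hasDerivAt_functional (p δ : Fin q → ℝ) (t : ℝ)
    (hN : 0 < vertexSum k β B (p + t • δ)) (hD : 0 < edgeForm β (p + t • δ) (p + t • δ)) :
    HasDerivAt (fun s : ℝ => functional (k + 1) q β B (p + s • δ))
      (((k : ℝ) + 1) *
        ((∑ σ, vertexWeight q B σ * cavity β (p + t • δ) σ ^ k * cavity β δ σ) /
            vertexSum k β B (p + t • δ) -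
          edgeForm β (p + t • δ) δ / edgeForm β (p + t • δ) (p + t • δ))) t := by
  simp only [functional_eq]
  have h1 := (hasDerivAt_vertexSum (k := k) (β := β) (B := B) p δ t).log hN.ne'
  have h2 := ((hasDerivAt_edgeForm (β := β) p δ t).log hD.ne').const_mul (((k : ℝ) + 1) / 2)
  refine (h1.sub h2).congr_deriv ?_
  ring

/-- The Bethe functional increases in the direction in which the recursion moves: along a line
whose direction `δ` contains the step `BP h - h = r δ`, its derivative has the sign of `r`. -/
lemma hasDerivAt_functional_of_bp_eq (hβ : 0 < β) {p δ : Fin q → ℝ} {t r : ℝ}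
    (hh : p + t • δ ∈ stdSimplex ℝ (Fin q)) (hδ : ∑ σ, δ σ = 0) (hδ0 : δ ≠ 0)
    (hbp : bp (k + 1) q β B (p + t • δ) = p + t • δ + r • δ) :
    ∃ K : ℝ, 0 < K ∧
      HasDerivAt (fun s : ℝ => functional (k + 1) q β B (p + s • δ)) (r * K) t := by
  have key := hasDerivAt_functional (k := k) (B := B) p δ t (vertexSum_pos hβ.le hh)
    (edgeForm_pos hβ.le hh hh)
  have hbm := bp_mem (k := k) (B := B) hβ.le hh
  have hz := bpSum_pos (k := k) (B := B) hβ.le hh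
  rw [sum_vertexWeight_mul_cavity hβ.le hh, vertexSum_eq hβ.le hh] at key
  set h := p + t • δ with hdef
  clear_value h
  have hE := edgeForm_pos hβ.le hbm hh
  have hD := edgeForm_pos hβ.le hh hh
  have hG := gram_pos hβ hh hδ hδ0
  refine ⟨((k : ℝ) + 1) * ((edgeForm β δ δ * edgeForm β h h - edgeForm β h δ ^ 2) /
    (edgeForm β (bp (k + 1) q β B h) h * edgeForm β h h)), by positivity, ?_⟩
  refine key.congr_deriv ?_
  rw [mul_div_mul_left _ _ hz.ne', div_sub_div _ _ hE.ne' hD.ne', mul_left_comm, ← mul_div_assoc r]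
  congr 2
  rw [hbp, edgeForm_add_smul_left, edgeForm_add_smul_left, edgeForm_comm δ h]
  ring

end

/-! ### Maximizers on the simplex -/

section

lemma eventually_pos_of_hasDerivAt {g : ℝ → ℝ} {g' : ℝ} (hg : HasDerivAt g g' 0) (h0 : g 0 = 0)
    (hpos : 0 < g') : ∀ᶠ t in 𝓝[>] (0 : ℝ), 0 < g t := by
  have h1 := eventually_nhdsWithin_sign_eq_of_deriv_pos (by rwa [hg.deriv]) h0
  filter_upwards [nhdsWithin_le_nhds h1, self_mem_nhdsWithin] with t ht htpos
  rw [sub_zero, sign_pos (show (0 : ℝ) < t from htpos)] at ht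
  exact sign_eq_one_iff.1 ht

variable {k q : ℕ} [NeZero q] {β B : ℝ} {h : Fin q → ℝ}

lemma continuousOn_functional (hβ : 0 ≤ β) :
    ContinuousOn (functional (k + 1) q β B) (stdSimplex ℝ (Fin q)) := by
  have e : functional (k + 1) q β B = fun h =>
      Real.log (vertexSum k β B h) - ((k : ℝ) + 1) / 2 * Real.log (edgeForm β h h) :=
    funext functional_eq
  have hc1 : Continuous fun h : Fin q → ℝ => vertexSum k β B h := by
    unfold vertexSum cavity; fun_prop
  have hc2 : Continuous fun h : Fin q → ℝ => edgeForm β h h := by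
    unfold edgeForm; fun_prop
  rw [e]
  exact (hc1.continuousOn.log fun h hh => (vertexSum_pos hβ hh).ne').sub
    (continuousOn_const.mul (hc2.continuousOn.log fun h hh => (edgeForm_pos hβ hh hh).ne'))

lemma exists_isMaxOn_functional (hβ : 0 ≤ β) :
    ∃ h ∈ stdSimplex ℝ (Fin q), IsMaxOn (functional (k + 1) q β B) (stdSimplex ℝ (Fin q)) h :=
  (isCompact_stdSimplex ℝ (Fin q)).exists_isMaxOn
    ⟨_, single_mem_stdSimplex ℝ (0 : Fin q)⟩ (continuousOn_functional hβ)

/-- A maximizer of the Bethe functional on the simplex is a fixed point of the recursion,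
even if it is not assumed to lie in the interior: the functional increases towards `BP h`. -/
lemma bp_eq_of_isMaxOn (hβ : 0 < β) (hh : h ∈ stdSimplex ℝ (Fin q))
    (hmax : IsMaxOn (functional (k + 1) q β B) (stdSimplex ℝ (Fin q)) h) :
    bp (k + 1) q β B h = h := by
  by_contra hne
  have hb := bp_mem (k := k) (B := B) hβ.le hh
  have hsum : ∑ σ, (bp (k + 1) q β B h - h) σ = 0 := by
    simp only [Pi.sub_apply, Finset.sum_sub_distrib, hb.2, hh.2, sub_self]
  obtain ⟨K, hK, hder⟩ := hasDerivAt_functional_of_bp_eq (k := k) (B := B) (t := 0) (r := 1) hβ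
    (p := h) (δ := bp (k + 1) q β B h - h) (by simpa using hh) hsum (sub_ne_zero.2 hne) (by simp)
  have hev := eventually_pos_of_hasDerivAt (hder.sub_const (functional (k + 1) q β B h))
    (by simp) (by simpa using hK)
  have hlt : ∀ᶠ t in 𝓝[>] (0 : ℝ), t < 1 :=
    nhdsWithin_le_nhds (gt_mem_nhds one_pos)
  obtain ⟨t, ht, ht1, ht0⟩ := (hev.and (hlt.and self_mem_nhdsWithin)).exists
  have hmem : h + t • (bp (k + 1) q β B h - h) ∈ stdSimplex ℝ (Fin q) :=
    (convex_stdSimplex ℝ (Fin q)).add_smul_sub_mem hh hb ⟨le_of_lt ht0, ht1.le⟩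
  exact absurd (hmax hmem) (not_le.2 (sub_pos.1 ht))

lemma functional_smul (hβ : 0 ≤ β) {c : ℝ} (hc : 0 < c) (hh : h ∈ stdSimplex ℝ (Fin q)) :
    functional (k + 1) q β B (c • h) = functional (k + 1) q β B h := by
  have hv : vertexSum k β B (c • h) = c ^ (k + 1) * vertexSum k β B h := by
    simp only [vertexSum, cavity_smul, Finset.mul_sum]
    exact Finset.sum_congr rfl fun σ _ => by ring
  rw [functional_eq, functional_eq, hv, edgeForm_smul_smul,
    Real.log_mul (by positivity) (vertexSum_pos hβ hh).ne',
    Real.log_mul (by positivity) (edgeForm_pos hβ hh hh).ne', Real.log_pow, Real.log_pow]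
  push_cast
  ring

/-- By homogeneity of degree zero, a maximizer on the simplex is one on the positive cone. -/
lemma functional_le_of_isMaxOn (hβ : 0 ≤ β)
    (hmax : IsMaxOn (functional (k + 1) q β B) (stdSimplex ℝ (Fin q)) h)
    {g : Fin q → ℝ} (hg : ∀ σ, 0 < g σ) :
    functional (k + 1) q β B g ≤ functional (k + 1) q β B h := by
  have hS : 0 < ∑ σ, g σ := Finset.sum_pos (fun σ _ => hg σ) Finset.univ_nonempty
  have hmem : (∑ σ, g σ)⁻¹ • g ∈ stdSimplex ℝ (Fin q) :=
    ⟨fun σ => mul_nonneg (inv_pos.2 hS).le (hg σ).le, by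
      simp only [Pi.smul_apply, smul_eq_mul, ← Finset.mul_sum]
      exact inv_mul_cancel₀ hS.ne'⟩
  have := functional_smul (k := k) (B := B) hβ hS hmem
  rw [smul_inv_smul₀ hS.ne'] at this
  rw [this]
  exact hmax hmem

/-- Second-order condition at a maximizer: with `γ = e^β - 1`, the inequality
`1 + γ h σ < k γ h σ` cannot hold at two different spins. If it does, then a direction whose field is
supported on these two spins and orthogonal to `h` increases the functional to second order. -/
lemma exists_le_of_isMaxOn (hβ : 0 < β) (hh : h ∈ stdSimplex ℝ (Fin q))
    (hmax : IsMaxOn (functional (k + 1) q β B) (stdSimplex ℝ (Fin q)) h) {a b : Fin q} (hab : a ≠ b)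
    (ha : cavity β h a < k * coupling β * h a) : k * coupling β * h b ≤ cavity β h b := by
  by_contra! hb
  have hγ := coupling_pos hβ
  have hfix := bp_eq_of_isMaxOn hβ hh hmax
  have hz := bpSum_pos (k := k) (B := B) hβ.le hh
  have hhpos : ∀ σ, 0 < h σ := fun σ => by
    rw [← hfix]; exact bp_pos hβ.le hh σ
  have hk : k ≠ 0 := by
    rintro rfl
    have := cavity_pos hβ.le hh a
    simp at ha; linarith
  have hw : ∀ σ, vertexWeight q B σ * cavity β h σ ^ k = bpSum k β B h * h σ := fun σ => by
    conv_rhs => rw [← congrFun hfix σ, bp_apply]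
    rw [mul_inv_cancel_left₀ hz.ne']
  -- `δ` is the vector whose field is `η`, and `η` is orthogonal to `h`.
  obtain ⟨η, hη⟩ : ∃ η : Fin q → ℝ, η = h b • Pi.single a 1 - h a • Pi.single b 1 := ⟨_, rfl⟩
  have hηa : η a = h b := by simp [hη, hab]
  have hηb : η b = -h a := by simp [hη, hab.symm]
  have hsum : ∀ F : Fin q → ℝ, ∑ σ, F σ * η σ = h b * F a - h a * F b := fun F => by
    simp [hη, mul_sub, Finset.sum_sub_distrib, Pi.single_apply, mul_comm]
  obtain ⟨s, hs⟩ : ∃ s : ℝ, s = (h b - h a) / (coupling β + q) := ⟨_, rfl⟩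
  obtain ⟨δ, hδ⟩ : ∃ δ : Fin q → ℝ, δ = fun σ => (η σ - s) / coupling β := ⟨_, rfl⟩
  have hγq : 0 < coupling β + q := by positivity
  have hs' : s * (coupling β + q) = h b - h a := by rw [hs]; field_simp
  have hδsum : ∑ σ, δ σ = s := by
    have h1 : ∑ σ, η σ = h b - h a := by simpa using hsum fun _ => 1
    simp only [hδ, ← Finset.sum_div, Finset.sum_sub_distrib, h1, Finset.sum_const,
      Finset.card_univ, Fintype.card_fin, nsmul_eq_mul]
    rw [div_eq_iff hγ.ne']
    linarith
  have hcav : ∀ σ, cavity β δ σ = η σ := fun σ => by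
    rw [cavity, hδsum, hδ]
    field_simp
    ring
  have hEh : edgeForm β h δ = 0 := by
    rw [← sum_mul_cavity]
    simp only [hcav, hsum]
    ring
  have hEδ : coupling β * edgeForm β δ δ ≤ h a ^ 2 + h b ^ 2 := by
    have h1 : edgeForm β δ δ = h b * δ a - h a * δ b := by
      rw [← sum_mul_cavity]
      simp only [hcav, hsum]
    have h2 : coupling β * edgeForm β δ δ = h a ^ 2 + h b ^ 2 - s * (h b - h a) := by
      rw [h1, hδ]
      simp only [hηa, hηb]
      field_simp
      ring
    rw [h2, ← hs']
    nlinarith [mul_nonneg (sq_nonneg s) hγq.le]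
  set A : ℝ → ℝ := fun t =>
    ∑ σ, vertexWeight q B σ * cavity β (h + t • δ) σ ^ k * cavity β δ σ with hA
  have hA0 : A 0 = 0 := by
    simp only [hA, zero_smul, add_zero]
    rw [sum_vertexWeight_mul_cavity hβ.le hh, hfix, hEh, mul_zero]
  have hAder : HasDerivAt A
      (∑ σ, (vertexWeight q B σ * (k * cavity β h σ ^ (k - 1)) * η σ) * η σ) 0 := by
    simp only [hA, cavity_add_smul, hcav]
    refine HasDerivAt.fun_sum fun σ _ => ?_
    have h1 : HasDerivAt (fun t : ℝ => cavity β h σ + t * η σ) (η σ) 0 := by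
      simpa using ((hasDerivAt_id (0 : ℝ)).mul_const (η σ)).const_add (cavity β h σ)
    refine (((h1.fun_pow k).const_mul (vertexWeight q B σ)).mul_const (η σ)).congr_deriv ?_
    simp only [zero_mul, add_zero]
    ring
  rw [hsum, hηa, hηb] at hAder
  have hstep : ∀ σ, cavity β h σ < k * coupling β * h σ →
      bpSum k β B h < coupling β * (vertexWeight q B σ * (k * cavity β h σ ^ (k - 1))) := by
    intro σ hσ
    have hu := cavity_pos hβ.le hh σ
    have h1 : vertexWeight q B σ * cavity β h σ ^ (k - 1) * cavity β h σ =
        bpSum k β B h * h σ := by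
      rw [← hw σ, mul_assoc, pow_sub_one_mul hk]
    refine lt_of_mul_lt_mul_right ?_ hu.le
    calc bpSum k β B h * cavity β h σ < bpSum k β B h * (k * coupling β * h σ) := by gcongr
      _ = k * coupling β * (bpSum k β B h * h σ) := by ring
      _ = _ := by rw [← h1]; ring
  set D := edgeForm β h h with hDdef
  have hD : 0 < D := edgeForm_pos hβ.le hh hh
  have hN : vertexSum k β B h = bpSum k β B h * D := by rw [vertexSum_eq hβ.le hh, hfix]
  have hDt : ∀ t : ℝ, edgeForm β (h + t • δ) δ = t * edgeForm β δ δ := fun t => by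
    rw [edgeForm_add_smul_left, hEh, zero_add]
  -- `g` has the sign of the derivative of the functional along `h + t δ`.
  set g : ℝ → ℝ := fun t => A t * edgeForm β (h + t • δ) (h + t • δ) -
    t * edgeForm β δ δ * vertexSum k β B (h + t • δ) with hg
  have hgder := (hAder.fun_mul (hasDerivAt_edgeForm (β := β) h δ 0)).fun_sub
    (((hasDerivAt_id (0 : ℝ)).mul_const (edgeForm β δ δ)).fun_mul
      (hasDerivAt_vertexSum (k := k) (β := β) (B := B) h δ 0))
  simp only [id_eq, hA0, zero_smul, add_zero, zero_mul, one_mul] at hgder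
  have hgpos : ∀ᶠ t in 𝓝[>] (0 : ℝ), 0 < g t := by
    refine eventually_pos_of_hasDerivAt hgder (by simp [hg, hA0]) ?_
    rw [← hDdef, hN]
    have h1 := hstep a ha
    have h2 := hstep b hb
    have h3 := mul_lt_mul_of_pos_right h1 (pow_pos (hhpos b) 2)
    have h4 := mul_lt_mul_of_pos_right h2 (pow_pos (hhpos a) 2)
    have h5 := mul_le_mul_of_nonneg_left hEδ hz.le
    refine pos_of_mul_pos_right (a := coupling β / D) ?_ (by positivity)
    field_simp
    nlinarith
  have hcont : ∀ σ, Continuous fun t : ℝ => (h + t • δ) σ := fun σ => by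
    simp only [Pi.add_apply, Pi.smul_apply]; fun_prop
  have hpos : ∀ᶠ t in 𝓝[>] (0 : ℝ), ∀ σ, 0 < (h + t • δ) σ :=
    nhdsWithin_le_nhds <| eventually_all.2 fun σ =>
      (hcont σ).continuousAt.eventually (lt_mem_nhds (by simpa using hhpos σ))
  obtain ⟨ε, hε, hsub⟩ := mem_nhdsGT_iff_exists_Ioo_subset.1 (hgpos.and hpos)
  have hε0 : (0 : ℝ) < ε := hε
  have hposIcc : ∀ t ∈ Set.Icc (0 : ℝ) (ε / 2), ∀ σ, 0 < (h + t • δ) σ := by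
    intro t ht
    rcases ht.1.eq_or_lt with rfl | h0
    · simpa using hhpos
    · exact (hsub ⟨h0, by linarith [ht.2]⟩).2
  have hfder : ∀ t ∈ Set.Icc (0 : ℝ) (ε / 2), HasDerivAt
      (fun s : ℝ => functional (k + 1) q β B (h + s • δ)) (((k : ℝ) + 1) *
        (g t / (vertexSum k β B (h + t • δ) * edgeForm β (h + t • δ) (h + t • δ)))) t ∧
      0 < vertexSum k β B (h + t • δ) * edgeForm β (h + t • δ) (h + t • δ) := by
    intro t ht
    have hp := hposIcc t ht
    have hS : 0 < ∑ σ, (h + t • δ) σ := Finset.sum_pos (fun σ _ => hp σ) Finset.univ_nonempty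
    have hNt : 0 < vertexSum k β B (h + t • δ) :=
      Finset.sum_pos (fun σ _ => mul_pos (vertexWeight_pos B σ)
        (pow_pos (add_pos hS (mul_pos hγ (hp σ))) _)) Finset.univ_nonempty
    have hDtpos : 0 < edgeForm β (h + t • δ) (h + t • δ) :=
      add_pos_of_pos_of_nonneg (mul_pos hS hS) (mul_nonneg hγ.le
        (Finset.sum_nonneg fun σ _ => (mul_pos (hp σ) (hp σ)).le))
    refine ⟨(hasDerivAt_functional h δ t hNt hDtpos).congr_deriv ?_, mul_pos hNt hDtpos⟩
    rw [div_sub_div _ _ hNt.ne' hDtpos.ne', hDt, hg]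
    congr 2
    simp only [hA]
    ring
  have hmono : StrictMonoOn (fun s : ℝ => functional (k + 1) q β B (h + s • δ))
      (Set.Icc 0 (ε / 2)) := by
    refine strictMonoOn_of_deriv_pos (convex_Icc _ _)
      (fun t ht => (hfder t ht).1.continuousAt.continuousWithinAt) fun t ht => ?_
    rw [interior_Icc] at ht
    have h1 := hfder t ⟨ht.1.le, ht.2.le⟩
    rw [h1.1.deriv]
    have : 0 < g t := (hsub ⟨ht.1, by linarith [ht.2]⟩).1
    exact mul_pos (by positivity) (div_pos this h1.2)
  have hlt := hmono (Set.left_mem_Icc.2 (by positivity)) (Set.right_mem_Icc.2 (by positivity))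
    (half_pos hε0)
  simp only [zero_smul, add_zero] at hlt
  exact absurd (functional_le_of_isMaxOn hβ.le hmax
    (hposIcc _ (Set.right_mem_Icc.2 (by positivity)))) (not_le.2 hlt)

end

/-! ### Maximizers away from the favoured spin -/

section

variable {k q : ℕ} {β B : ℝ} {h : Fin q → ℝ}

variable [NeZero q]

lemma bpSum_mul_of_fixed (hβ : 0 ≤ β) (hh : h ∈ stdSimplex ℝ (Fin q))
    (hfix : bp (k + 1) q β B h = h) (σ : Fin q) :
    bpSum k β B h * h σ = vertexWeight q B σ * cavity β h σ ^ k := by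
  have h1 := congrFun hfix σ
  rw [bp_apply] at h1
  rw [← h1, mul_inv_cancel_left₀ (bpSum_pos hβ hh).ne']

/-- Away from the spin `0`, a fixed point solves `z s = (1 + γ s)^k` at each spin. As the right side
is strictly convex, its slope at the larger of two different solutions exceeds that of the left
side. -/
lemma cavity_lt_of_lt (hβ : 0 < β) (hk : 2 ≤ k) (hh : h ∈ stdSimplex ℝ (Fin q))
    (hfix : bp (k + 1) q β B h = h) {σ τ : Fin q} (hσ : σ ≠ 0) (hτ : τ ≠ 0) (hlt : h τ < h σ) :
    cavity β h σ < k * coupling β * h σ := by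
  have hγ := coupling_pos hβ
  have e1 := bpSum_mul_of_fixed hβ.le hh hfix σ
  have e2 := bpSum_mul_of_fixed hβ.le hh hfix τ
  rw [vertexWeight_of_ne B hσ, one_mul] at e1
  rw [vertexWeight_of_ne B hτ, one_mul] at e2
  have hu := cavity_pos hβ.le hh σ
  have hv := cavity_pos hβ.le hh τ
  have huv : cavity β h σ - cavity β h τ = coupling β * (h σ - h τ) := by
    simp only [cavity]; ring
  have hz := bpSum_pos (k := k) (B := B) hβ.le hh
  set u := cavity β h σ
  set v := cavity β h τ
  have hvu : v < u := by nlinarith [mul_pos hγ (sub_pos.2 hlt)]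
  have hb := one_add_mul_self_lt_rpow_one_add (s := v / u - 1) (p := k)
    (by linarith [div_pos hv hu]) (by
      have := (div_lt_one hu).2 hvu
      linarith) (by exact_mod_cast hk)
  rw [Real.rpow_natCast, add_sub_cancel, div_pow, ← e1, ← e2, mul_div_mul_left _ _ hz.ne'] at hb
  have hσpos : 0 < h σ := by
    have : 0 < bpSum k β B h * h σ := by rw [e1]; positivity
    exact pos_of_mul_pos_right this hz.le
  have h2 : (h σ - h τ) * u < (h σ - h τ) * (k * coupling β * h σ) := by
    have h3 : 1 - h τ / h σ < k * (1 - v / u) := by linarith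
    have h4 : (h σ - h τ) / h σ < k * (u - v) / u := by
      convert h3 using 1 <;> field_simp
    rw [div_lt_div_iff₀ hσpos hu, huv] at h4
    linarith
  exact lt_of_mul_lt_mul_left h2 (sub_pos.2 hlt).le

/-- A maximizer whose largest coordinate is the one at the spin `0` is constant on the other
spins. -/
lemma eq_of_isMaxOn (hβ : 0 < β) (hk : 2 ≤ k) (hh : h ∈ stdSimplex ℝ (Fin q))
    (hmax : IsMaxOn (functional (k + 1) q β B) (stdSimplex ℝ (Fin q)) h) (h0 : ∀ σ, h σ ≤ h 0)
    {σ τ : Fin q} (hσ : σ ≠ 0) (hτ : τ ≠ 0) : h σ = h τ := by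
  by_contra hne
  wlog hlt : h τ < h σ generalizing σ τ
  · exact this hτ hσ (Ne.symm hne) (lt_of_le_of_ne (not_lt.1 hlt) hne)
  have h1 := cavity_lt_of_lt hβ hk hh (bp_eq_of_isMaxOn hβ hh hmax) hσ hτ hlt
  refine absurd (exists_le_of_isMaxOn hβ hh hmax hσ h1) (not_le.2 ?_)
  rw [cavity_of_mem hh] at h1 ⊢
  have hk' : (2 : ℝ) ≤ k := by exact_mod_cast hk
  have : 0 ≤ ((k : ℝ) - 1) * coupling β * (h 0 - h σ) :=
    mul_nonneg (mul_nonneg (by linarith) (coupling_pos hβ).le) (sub_nonneg.2 (h0 σ))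
  linarith

end

/-! ### Permuting the spins -/

section

variable {k q : ℕ} {β B : ℝ} {h : Fin q → ℝ}

lemma cavity_comp (h : Fin q → ℝ) (e : Equiv.Perm (Fin q)) (σ : Fin q) :
    cavity β (h ∘ e) σ = cavity β h (e σ) := by
  simp only [cavity, Function.comp_apply]
  rw [Equiv.sum_comp e h]

lemma edgeForm_comp (h : Fin q → ℝ) (e : Equiv.Perm (Fin q)) :
    edgeForm β (h ∘ e) (h ∘ e) = edgeForm β h h := by
  simp only [edgeForm, Function.comp_apply]
  rw [Equiv.sum_comp e h, Equiv.sum_comp e fun σ => h σ * h σ]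

lemma comp_mem (hh : h ∈ stdSimplex ℝ (Fin q)) (e : Equiv.Perm (Fin q)) :
    h ∘ e ∈ stdSimplex ℝ (Fin q) :=
  ⟨fun σ => hh.1 (e σ), (Equiv.sum_comp e h).trans hh.2⟩

lemma cavity_le_cavity (hβ : 0 ≤ β) {σ τ : Fin q} (hle : h σ ≤ h τ) :
    cavity β h σ ≤ cavity β h τ := by
  unfold cavity
  gcongr
  exact coupling_nonneg hβ

variable [NeZero q]

lemma vertexSum_eq_add (h : Fin q → ℝ) :
    vertexSum k β B h =
      ∑ σ, cavity β h σ ^ (k + 1) + (Real.exp B - 1) * cavity β h 0 ^ (k + 1) := by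
  have hw : ∀ σ : Fin q, vertexWeight q B σ = 1 + if σ = 0 then Real.exp B - 1 else 0 := by
    intro σ
    by_cases hσ : σ = 0
    · simp [hσ, vertexWeight_zero]
    · simp [hσ, vertexWeight_of_ne]
  simp [vertexSum, hw, add_mul, Finset.sum_add_distrib]

lemma vertexSum_comp (h : Fin q → ℝ) (e : Equiv.Perm (Fin q)) :
    vertexSum k β B (h ∘ e) = vertexSum k β B h +
      (Real.exp B - 1) * (cavity β h (e 0) ^ (k + 1) - cavity β h 0 ^ (k + 1)) := by
  simp only [vertexSum_eq_add, cavity_comp]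
  rw [Equiv.sum_comp e fun σ => cavity β h σ ^ (k + 1)]
  ring

lemma functional_le_comp (hβ : 0 ≤ β) (hB : 0 ≤ B) (hh : h ∈ stdSimplex ℝ (Fin q))
    (e : Equiv.Perm (Fin q)) (hle : h 0 ≤ h (e 0)) :
    functional (k + 1) q β B h ≤ functional (k + 1) q β B (h ∘ e) := by
  rw [functional_eq, functional_eq, edgeForm_comp]
  have h1 : cavity β h 0 ^ (k + 1) ≤ cavity β h (e 0) ^ (k + 1) :=
    pow_le_pow_left₀ (cavity_pos hβ hh 0).le (cavity_le_cavity hβ hle) _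
  have h2 : vertexSum k β B h ≤ vertexSum k β B (h ∘ e) := by
    rw [vertexSum_comp]
    have := mul_nonneg (sub_nonneg.2 (Real.one_le_exp hB)) (sub_nonneg.2 h1)
    linarith
  have := Real.log_le_log (vertexSum_pos hβ hh) h2
  linarith

lemma functional_lt_comp (hβ : 0 < β) (hB : 0 < B) (hh : h ∈ stdSimplex ℝ (Fin q))
    (e : Equiv.Perm (Fin q)) (hlt : h 0 < h (e 0)) :
    functional (k + 1) q β B h < functional (k + 1) q β B (h ∘ e) := by
  rw [functional_eq, functional_eq, edgeForm_comp]
  have h0 : cavity β h 0 < cavity β h (e 0) :=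
    add_lt_add_right (mul_lt_mul_of_pos_left hlt (coupling_pos hβ)) _
  have h1 : cavity β h 0 ^ (k + 1) < cavity β h (e 0) ^ (k + 1) :=
    pow_lt_pow_left₀ h0 (cavity_pos hβ.le hh 0).le (Nat.succ_ne_zero k)
  have h2 : vertexSum k β B h < vertexSum k β B (h ∘ e) := by
    rw [vertexSum_comp]
    have := mul_pos (sub_pos.2 (Real.one_lt_exp_iff.2 hB)) (sub_pos.2 h1)
    linarith
  have := Real.log_lt_log (vertexSum_pos hβ.le hh) h2
  linarith

/-- Moving the largest coordinate to the favoured spin `0` keeps a maximizer a maximizer. -/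
lemma exists_isMaxOn_forall_le (hβ : 0 ≤ β) (hB : 0 ≤ B) :
    ∃ h ∈ stdSimplex ℝ (Fin q),
      IsMaxOn (functional (k + 1) q β B) (stdSimplex ℝ (Fin q)) h ∧ ∀ σ, h σ ≤ h 0 := by
  obtain ⟨h, hh, hmax⟩ := exists_isMaxOn_functional (k := k) (q := q) (B := B) hβ
  obtain ⟨τ, hτ⟩ := Finite.exists_max h
  refine ⟨h ∘ Equiv.swap 0 τ, comp_mem hh _,
    isMaxOn_iff.2 fun g hg => (isMaxOn_iff.1 hmax g hg).trans ?_, fun σ => ?_⟩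
  · exact functional_le_comp hβ hB hh _ (by simpa using hτ 0)
  · simpa using hτ (Equiv.swap 0 τ σ)

end

/-! ### The measures that distinguish only the spin `0` -/

section

variable {k q : ℕ} {β B : ℝ} {h : Fin q → ℝ}

lemma cast_sub_one_pos (hq : 2 ≤ q) : (0 : ℝ) < q - 1 := by
  have : (2 : ℝ) ≤ q := by exact_mod_cast hq
  linarith

/-- The field of `biased q x` at the spins other than `0`. -/
noncomputable def otherField (q : ℕ) (β x : ℝ) : ℝ := 1 + coupling β * ((1 - x) / (q - 1))

lemma otherField_pos (hβ : 0 ≤ β) (hq : 2 ≤ q) {x : ℝ} (hx : x ≤ 1) : 0 < otherField q β x := by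
  have := mul_nonneg (coupling_nonneg hβ)
    (div_nonneg (sub_nonneg.2 hx) (cast_sub_one_pos hq).le)
  unfold otherField; linarith

lemma otherField_antitone (hβ : 0 ≤ β) (hq : 2 ≤ q) {x y : ℝ} (hxy : x ≤ y) :
    otherField q β y ≤ otherField q β x := by
  have := cast_sub_one_pos hq
  have := coupling_nonneg hβ
  unfold otherField
  gcongr

lemma favouredField_pos (hβ : 0 ≤ β) {x : ℝ} (hx : 0 ≤ x) : 0 < 1 + coupling β * x := by
  have := mul_nonneg (coupling_nonneg hβ) hx
  linarith

lemma biasedStep_denom_pos (hβ : 0 ≤ β) (hq : 2 ≤ q) {x : ℝ} (hx : x ∈ Set.Icc (0 : ℝ) 1) :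
    0 < Real.exp B * (1 + coupling β * x) ^ k + (q - 1) * otherField q β x ^ k :=
  add_pos (mul_pos (Real.exp_pos B) (pow_pos (favouredField_pos hβ hx.1) k))
    (mul_pos (cast_sub_one_pos hq) (pow_pos (otherField_pos hβ hq hx.2) k))

variable [NeZero q]

/-- The vector with value `x` at the spin `0` whose remaining mass `1 - x` is spread evenly over the
other spins. It is meant for `q ≥ 2`. -/
noncomputable def biased (q : ℕ) [NeZero q] (x : ℝ) : Fin q → ℝ :=
  fun σ => if σ = 0 then x else (1 - x) / (q - 1)

lemma sum_ite_zero (a b : ℝ) :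
    ∑ σ : Fin q, (if σ = 0 then a else b) = a + (q - 1) * b := by
  have : ∀ σ : Fin q, (if σ = 0 then a else b) = b + if σ = 0 then a - b else 0 := by
    intro σ; split_ifs <;> ring
  simp only [this, Finset.sum_add_distrib]
  simp
  ring

lemma biased_zero (x : ℝ) : biased q x 0 = x := by simp [biased]

lemma biased_mem (hq : 2 ≤ q) {x : ℝ} (hx : x ∈ Set.Icc (0 : ℝ) 1) :
    biased q x ∈ stdSimplex ℝ (Fin q) := by
  have hq1 := cast_sub_one_pos hq
  refine ⟨fun σ => ?_, ?_⟩
  · unfold biased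
    split_ifs
    exacts [hx.1, div_nonneg (by linarith [hx.2]) hq1.le]
  · unfold biased
    rw [sum_ite_zero]
    field_simp
    ring

lemma eq_biased (hq : 2 ≤ q) (hh : h ∈ stdSimplex ℝ (Fin q))
    (heq : ∀ σ τ : Fin q, σ ≠ 0 → τ ≠ 0 → h σ = h τ) : h = biased q (h 0) := by
  have hq1 := cast_sub_one_pos hq
  funext σ
  by_cases hσ : σ = 0
  · simp [hσ, biased]
  · have h1 : h = fun τ => if τ = 0 then h 0 else h σ := by
      funext τ
      split_ifs with hτ
      exacts [by rw [hτ], heq τ σ hτ hσ]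
    have h2 : ∑ τ, h τ = h 0 + (q - 1) * h σ := by
      conv_lhs => rw [h1]
      exact sum_ite_zero _ _
    rw [hh.2] at h2
    simp only [biased, if_neg hσ]
    rw [eq_div_iff hq1.ne']
    linarith

lemma bp_biased (hβ : 0 ≤ β) (hq : 2 ≤ q) {x : ℝ} (hx : x ∈ Set.Icc (0 : ℝ) 1) :
    bp (k + 1) q β B (biased q x) = biased q (bp (k + 1) q β B (biased q x) 0) := by
  have hm := biased_mem hq hx
  refine eq_biased hq (bp_mem hβ hm) fun σ τ hσ hτ => ?_
  rw [bp_apply, bp_apply, vertexWeight_of_ne B hσ, vertexWeight_of_ne B hτ, cavity_of_mem hm,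
    cavity_of_mem hm]
  simp [biased, hσ, hτ]

lemma uniform_eq_biased (hq : 2 ≤ q) : uniform q = biased q (q : ℝ)⁻¹ := by
  have hq1 := cast_sub_one_pos hq
  have hq0 : (q : ℝ) ≠ 0 := by positivity
  funext σ
  simp only [uniform, biased]
  split_ifs
  · rfl
  · field_simp

lemma pointMass_eq_biased : pointMass q = biased q 1 := by
  funext σ
  simp [pointMass, biased, Pi.single_apply]

/-- The recursion read off at the spin `0`, on the measures `biased q x`. -/
noncomputable def biasedStep (k q : ℕ) [NeZero q] (β B x : ℝ) : ℝ :=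
  bp (k + 1) q β B (biased q x) 0

lemma biasedStep_eq (hq : 2 ≤ q) {x : ℝ} (hx : x ∈ Set.Icc (0 : ℝ) 1) :
    biasedStep k q β B x = Real.exp B * (1 + coupling β * x) ^ k /
      (Real.exp B * (1 + coupling β * x) ^ k + (q - 1) * otherField q β x ^ k) := by
  have hm := biased_mem hq hx
  have hs : bpSum k β B (biased q x) =
      Real.exp B * (1 + coupling β * x) ^ k + (q - 1) * otherField q β x ^ k := by
    rw [← sum_ite_zero, bpSum]
    refine Finset.sum_congr rfl fun σ _ => ?_
    rw [cavity_of_mem hm]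
    by_cases hσ : σ = 0
    · simp [hσ, biased, vertexWeight_zero]
    · simp [hσ, biased, vertexWeight_of_ne, otherField]
  rw [biasedStep, bp_apply, hs, cavity_of_mem hm, biased_zero, vertexWeight_zero, div_eq_inv_mul]

lemma continuousOn_biasedStep (hβ : 0 ≤ β) (hq : 2 ≤ q) :
    ContinuousOn (biasedStep k q β B) (Set.Icc 0 1) := by
  refine ContinuousOn.congr ?_ fun x hx => biasedStep_eq hq hx
  refine ContinuousOn.div ?_ ?_ fun x hx => (biasedStep_denom_pos hβ hq hx).ne'
  · fun_prop
  · unfold otherField; fun_prop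

lemma monotoneOn_biasedStep (hβ : 0 ≤ β) (hq : 2 ≤ q) :
    MonotoneOn (biasedStep k q β B) (Set.Icc 0 1) := by
  intro x hx y hy hxy
  rw [biasedStep_eq hq hx, biasedStep_eq hq hy,
    div_le_div_iff₀ (biasedStep_denom_pos hβ hq hx) (biasedStep_denom_pos hβ hq hy), mul_add,
    mul_add, mul_comm (Real.exp B * (1 + coupling β * y) ^ k) (Real.exp B * _)]
  refine add_le_add_right ?_ _
  have h1 := otherField_pos hβ hq hy.2
  have h2 := favouredField_pos hβ hx.1
  have h3 := cast_sub_one_pos hq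
  have h4 := coupling_nonneg hβ
  have h5 := otherField_antitone hβ hq hxy
  have h6 := favouredField_pos hβ hy.1
  gcongr

lemma mapsTo_biasedStep (hβ : 0 ≤ β) (hB : 0 ≤ B) (hq : 2 ≤ q) :
    Set.MapsTo (biasedStep k q β B) (Set.Icc (q : ℝ)⁻¹ 1) (Set.Icc (q : ℝ)⁻¹ 1) := by
  have hq1 := cast_sub_one_pos hq
  have hq0 : (0 : ℝ) < q := by linarith
  have hqi : (q : ℝ)⁻¹ ∈ Set.Icc (0 : ℝ) 1 :=
    ⟨by positivity, inv_le_one_of_one_le₀ (by linarith)⟩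
  intro x hx
  have hx' : x ∈ Set.Icc (0 : ℝ) 1 := ⟨hqi.1.trans hx.1, hx.2⟩
  refine ⟨le_trans ?_ (monotoneOn_biasedStep hβ hq hqi hx' hx.1), ?_⟩
  · -- At the uniform measure all fields agree, and the vertex weight favours the spin `0`.
    have hu : otherField q β (q : ℝ)⁻¹ = 1 + coupling β * (q : ℝ)⁻¹ := by
      unfold otherField; field_simp
    have hpos := pow_pos (favouredField_pos hβ hqi.1) k
    rw [biasedStep_eq hq hqi, hu, ← add_mul, mul_div_mul_right _ _ hpos.ne',
      inv_le_comm₀ hq0 (by positivity), inv_div, div_le_iff₀ (Real.exp_pos B)]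
    nlinarith [Real.one_le_exp hB]
  · rw [biasedStep_eq hq hx', div_le_one (biasedStep_denom_pos hβ hq hx')]
    have := mul_pos hq1 (pow_pos (otherField_pos hβ hq hx'.2) k)
    linarith

lemma iterate_bp_biased (hβ : 0 ≤ β) (hB : 0 ≤ B) (hq : 2 ≤ q) {x : ℝ}
    (hx : x ∈ Set.Icc (q : ℝ)⁻¹ 1) (t : ℕ) :
    (bp (k + 1) q β B)^[t] (biased q x) = biased q ((biasedStep k q β B)^[t] x) := by
  induction t with
  | zero => rfl
  | succ t ih =>
    have hm := (mapsTo_biasedStep (k := k) hβ hB hq).iterate t hx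
    rw [Function.iterate_succ_apply', Function.iterate_succ_apply', ih,
      bp_biased hβ hq ⟨le_trans (by positivity) hm.1, hm.2⟩]
    rfl

lemma continuous_biased : Continuous (biased q) := by
  refine continuous_pi fun σ => ?_
  unfold biased
  split_ifs <;> fun_prop

/-- On the measures `biased q x`, the functional moves in the direction of the recursion. -/
lemma hasDerivAt_functional_biased (hβ : 0 < β) (hq : 2 ≤ q) {x : ℝ}
    (hx : x ∈ Set.Icc (0 : ℝ) 1) :
    ∃ K : ℝ, 0 < K ∧ HasDerivAt (fun s => functional (k + 1) q β B (biased q s))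
      ((biasedStep k q β B x - x) * K) x := by
  have hq1 := cast_sub_one_pos hq
  obtain ⟨δ, hδ⟩ : ∃ δ : Fin q → ℝ, δ = fun σ => if σ = 0 then 1 else -1 / ((q : ℝ) - 1) :=
    ⟨_, rfl⟩
  have hline : ∀ s, biased q s = biased q 0 + s • δ := fun s => by
    funext σ
    simp only [biased, hδ, Pi.add_apply, Pi.smul_apply, smul_eq_mul]
    split_ifs
    · ring
    · field_simp
      ring
  have hsum : ∑ σ, δ σ = 0 := by
    rw [hδ, sum_ite_zero]; field_simp; ring
  have hδ0 : δ ≠ 0 := fun h0 => by simpa [hδ] using congrFun h0 0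
  have hbp := bp_biased (k := k) (B := B) hβ.le hq hx
  rw [funext hline]
  refine hasDerivAt_functional_of_bp_eq hβ (by rw [← hline]; exact biased_mem hq hx) hsum hδ0 ?_
  have hstep : biased q (biasedStep k q β B x) =
      biased q x + (biasedStep k q β B x - x) • δ := by
    rw [hline, hline x, add_assoc, ← add_smul, add_sub_cancel]
  rwa [← hline, hbp]

end

/-! ### Monotone iteration on an interval -/

lemma exists_tendsto_iterate_left {f : ℝ → ℝ} {l r : ℝ} (hlr : l ≤ r)
    (hmono : MonotoneOn f (Set.Icc l r)) (hc : ContinuousOn f (Set.Icc l r))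
    (hmap : Set.MapsTo f (Set.Icc l r) (Set.Icc l r)) :
    ∃ a ∈ Set.Icc l r, f a = a ∧ Tendsto (fun n : ℕ => f^[n] l) atTop (𝓝 a) ∧
      ∀ m ∈ Set.Icc l r, f m = m → a ≤ m := by
  have hl : l ∈ Set.Icc l r := Set.left_mem_Icc.2 hlr
  have hmem : ∀ n, f^[n] l ∈ Set.Icc l r := fun n => hmap.iterate n hl
  have hseq : Monotone fun n : ℕ => f^[n] l := by
    refine monotone_nat_of_le_succ fun n => ?_
    induction n with
    | zero => exact (hmem 1).1
    | succ n ih =>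
      rw [Function.iterate_succ_apply' f n, Function.iterate_succ_apply' f (n + 1)]
      exact hmono (hmem n) (hmem (n + 1)) ih
  obtain ⟨a, ha⟩ : ∃ a, Tendsto (fun n : ℕ => f^[n] l) atTop (𝓝 a) :=
    ⟨_, tendsto_atTop_ciSup hseq ⟨r, by rintro _ ⟨n, rfl⟩; exact (hmem n).2⟩⟩
  have haI : a ∈ Set.Icc l r := isClosed_Icc.mem_of_tendsto ha (Eventually.of_forall hmem)
  refine ⟨a, haI, ?_, ha, fun m hm hfm => le_of_tendsto' ha fun n => ?_⟩
  · have h1 : Tendsto (fun n : ℕ => f (f^[n] l)) atTop (𝓝 (f a)) :=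
      (hc a haI).tendsto.comp (tendsto_nhdsWithin_iff.2 ⟨ha, Eventually.of_forall hmem⟩)
    simp only [← Function.iterate_succ_apply' f] at h1
    exact tendsto_nhds_unique h1 (ha.comp (tendsto_add_atTop_nat 1))
  · induction n with
    | zero => exact hm.1
    | succ n ih =>
      rw [Function.iterate_succ_apply', ← hfm]
      exact hmono (hmem n) hm ih

lemma exists_tendsto_iterate_right {f : ℝ → ℝ} {l r : ℝ} (hlr : l ≤ r)
    (hmono : MonotoneOn f (Set.Icc l r)) (hc : ContinuousOn f (Set.Icc l r))
    (hmap : Set.MapsTo f (Set.Icc l r) (Set.Icc l r)) :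
    ∃ a ∈ Set.Icc l r, f a = a ∧ Tendsto (fun n : ℕ => f^[n] r) atTop (𝓝 a) ∧
      ∀ m ∈ Set.Icc l r, f m = m → m ≤ a := by
  have hneg : ∀ {x}, x ∈ Set.Icc (-r) (-l) → -x ∈ Set.Icc l r := fun hx =>
    ⟨le_neg.1 hx.2, neg_le.1 hx.1⟩
  have hneg' : ∀ {x}, x ∈ Set.Icc l r → -x ∈ Set.Icc (-r) (-l) := fun hx =>
    ⟨neg_le_neg hx.2, neg_le_neg hx.1⟩
  obtain ⟨a, ha, hfa, hlim, hle⟩ := exists_tendsto_iterate_left (f := fun x => -f (-x))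
    (neg_le_neg hlr)
    (fun x hx y hy hxy => neg_le_neg (hmono (hneg hy) (hneg hx) (neg_le_neg hxy)))
    ((hc.comp continuousOn_neg fun x hx => hneg hx).neg) (fun x hx => hneg' (hmap (hneg hx)))
  refine ⟨-a, hneg ha, neg_eq_iff_eq_neg.1 hfa, ?_, fun m hm hfm => ?_⟩
  · have hit : ∀ n : ℕ, f^[n] r = -(fun x => -f (-x))^[n] (-r) := fun n => by
      induction n with
      | zero => simp
      | succ n ih => rw [Function.iterate_succ_apply', Function.iterate_succ_apply', ih, neg_neg]
    simp only [hit]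
    exact hlim.neg
  · exact le_neg.1 (hle (-m) (hneg' hm) (by rw [neg_neg, hfm]))

/-! ### The fixed point equation on the biased measures -/

section

/-- At the ratio `y` of the fields at the spin `0` and at another spin, this polynomial vanishes
exactly when the biased measure with that ratio is a fixed point, provided `β > 0` and `q ≥ 2`. -/
noncomputable def ratioPoly (k q : ℕ) (β B y : ℝ) : ℝ :=
  Real.exp B * (y ^ (k + 1) - (1 + coupling β) * y ^ k) + ((q - 1 + coupling β) * y - (q - 1))

lemma deriv2_ratioPoly (m q : ℕ) (β B y : ℝ) :
    deriv^[2] (ratioPoly (m + 2) q β B) y = Real.exp B * ((m + 2) * y ^ m *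
      ((m + 3) * y - (1 + coupling β) * (m + 1))) := by
  have h1 : deriv (ratioPoly (m + 2) q β B) = fun y => Real.exp B *
      ((m + 3) * y ^ (m + 2) - (1 + coupling β) * ((m + 2) * y ^ (m + 1))) +
        (q - 1 + coupling β) := by
    funext y
    have h := (((hasDerivAt_pow (m + 2 + 1) y).fun_sub
      ((hasDerivAt_pow (m + 2) y).const_mul (1 + coupling β))).const_mul (Real.exp B)).fun_add
        (((hasDerivAt_id y).const_mul ((q : ℝ) - 1 + coupling β)).sub_const ((q : ℝ) - 1))
    refine h.deriv.trans ?_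
    simp only [Nat.add_sub_cancel, Nat.cast_add, Nat.cast_ofNat, Nat.cast_one]
    rw [show m + 2 - 1 = m + 1 from rfl]
    ring
  rw [Function.iterate_succ_apply, Function.iterate_one, h1]
  have h := (((((hasDerivAt_pow (m + 2) y).const_mul ((m : ℝ) + 3)).fun_sub
    (((hasDerivAt_pow (m + 1) y).const_mul ((m : ℝ) + 2)).const_mul
      (1 + coupling β))).const_mul (Real.exp B)).add_const ((q : ℝ) - 1 + coupling β))
  refine h.deriv.trans ?_
  simp only [Nat.add_sub_cancel, Nat.cast_add, Nat.cast_ofNat, Nat.cast_one]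
  rw [show m + 2 - 1 = m + 1 from rfl]
  ring

lemma continuous_ratioPoly (k q : ℕ) (β B : ℝ) : Continuous (ratioPoly k q β B) := by
  unfold ratioPoly; fun_prop

/-- On the positive half-line `ratioPoly` is first strictly concave and then strictly convex. Of
three zeros, the middle one lies in one of the two ranges, which fixes the sign on one side of
it. -/
lemma ratioPoly_sign {k : ℕ} (hk : 2 ≤ k) (q : ℕ) {β : ℝ} (hβ : 0 ≤ β) (B : ℝ) {y₁ y₂ y₃ : ℝ}
    (h0 : 0 < y₁) (h12 : y₁ < y₂) (h23 : y₂ < y₃) (e1 : ratioPoly k q β B y₁ = 0)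
    (e2 : ratioPoly k q β B y₂ = 0) (e3 : ratioPoly k q β B y₃ = 0) :
    (∀ y ∈ Set.Ioo y₁ y₂, 0 < ratioPoly k q β B y) ∨
      ∀ y ∈ Set.Ioo y₂ y₃, ratioPoly k q β B y < 0 := by
  obtain ⟨m, rfl⟩ := Nat.exists_eq_add_of_le' hk
  have hA : 0 < 1 + coupling β := by linarith [coupling_nonneg hβ]
  -- the inflection point
  obtain ⟨c, hc⟩ : ∃ c : ℝ, c = (1 + coupling β) * (m + 1) / (m + 3) := ⟨_, rfl⟩
  have hc0 : 0 < c := by rw [hc]; positivity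
  have hc' : (m + 3) * c = (1 + coupling β) * (m + 1) := by rw [hc]; field_simp
  rcases le_total y₂ c with hy | hy
  · left
    intro y hyI
    have hcc : StrictConcaveOn ℝ (Set.Icc 0 c) (ratioPoly (m + 2) q β B) := by
      refine strictConcaveOn_of_deriv2_neg (convex_Icc _ _)
        (continuous_ratioPoly _ _ _ _).continuousOn fun x hx => ?_
      rw [interior_Icc] at hx
      rw [deriv2_ratioPoly, ← hc', ← mul_sub]
      have := hx.1
      refine mul_neg_of_pos_of_neg (Real.exp_pos B) (mul_neg_of_pos_of_neg (by positivity)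
        (mul_neg_of_pos_of_neg (by positivity) (sub_neg.2 hx.2)))
    have := hcc.lt_on_openSegment (x := y₁) (y := y₂) ⟨h0.le, by linarith⟩ ⟨by linarith, hy⟩ h12.ne
      (by rwa [openSegment_eq_Ioo h12])
    rwa [e1, e2, min_self] at this
  · right
    intro y hyI
    have hcv : StrictConvexOn ℝ (Set.Ici c) (ratioPoly (m + 2) q β B) := by
      refine strictConvexOn_of_deriv2_pos (convex_Ici _)
        (continuous_ratioPoly _ _ _ _).continuousOn fun x hx => ?_
      rw [interior_Ici] at hx
      rw [deriv2_ratioPoly, ← hc', ← mul_sub]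
      have : 0 < x := hc0.trans hx
      exact mul_pos (Real.exp_pos B) (mul_pos (by positivity)
        (mul_pos (by positivity) (sub_pos.2 hx)))
    have := hcv.lt_on_openSegment (x := y₂) (y := y₃) hy (hy.trans h23.le) h23.ne
      (by rwa [openSegment_eq_Ioo h23])
    rwa [e2, e3, max_self] at this

variable {k q : ℕ} {β B : ℝ}

/-- The ratio of the field of `biased q x` at the spin `0` to that at another spin. -/
noncomputable def fieldRatio (q : ℕ) (β x : ℝ) : ℝ := (1 + coupling β * x) / otherField q β x

lemma fieldRatio_lt (hβ : 0 < β) (hq : 2 ≤ q) {x y : ℝ} (hx : 0 ≤ x) (hxy : x < y) (hy : y ≤ 1) :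
    fieldRatio q β x < fieldRatio q β y := by
  have hγ := coupling_pos hβ
  have h1 : 1 + coupling β * x < 1 + coupling β * y := by gcongr
  exact div_lt_div₀ h1 (otherField_antitone hβ.le hq hxy.le)
    (favouredField_pos hβ.le (hx.trans hxy.le)).le (otherField_pos hβ.le hq hy)

variable [NeZero q]

lemma biasedStep_sub (hβ : 0 < β) (hq : 2 ≤ q) {x : ℝ} (hx : x ∈ Set.Icc (0 : ℝ) 1) :
    ∃ C : ℝ, 0 < C ∧ biasedStep k q β B x - x = -(C * ratioPoly k q β B (fieldRatio q β x)) := by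
  have hq1 := cast_sub_one_pos hq
  have hγ := coupling_pos hβ
  have hv := otherField_pos hβ.le hq hx.2
  have hd := biasedStep_denom_pos (k := k) (B := B) hβ.le hq hx
  have hγq : 0 < coupling β + q := by linarith
  have hv' : (q - 1) * (otherField q β x - 1) = coupling β * (1 - x) := by
    unfold otherField; field_simp; ring
  have hr : fieldRatio q β x * otherField q β x = 1 + coupling β * x := by
    rw [fieldRatio, div_mul_cancel₀ _ hv.ne']
  rw [biasedStep_eq hq hx, ← hr]
  rw [← hr] at hd
  set v := otherField q β x
  set y := fieldRatio q β x
  refine ⟨(q - 1) * v ^ (k + 1) / (coupling β * (coupling β + q) *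
    (Real.exp B * (y * v) ^ k + (q - 1) * v ^ k)), by positivity, ?_⟩
  have hx' : coupling β * x = y * v - 1 := by linarith
  -- The relations below are homogeneous in the fields because the total mass is one.
  have hmass : y * v + (q - 1) * v = coupling β + q := by linarith
  have h1 : coupling β * (coupling β + q) * x = v * (y * (coupling β + q - 1) - (q - 1)) := by
    linear_combination (coupling β + q) * hx' + hmass
  have h2 : coupling β * (coupling β + q) * (1 - x) = (q - 1) * v * (1 + coupling β - y) := by
    linear_combination (-(coupling β + q)) * hv' + (q - 1) * hmass
  rw [div_mul_eq_mul_div, ← neg_div, eq_div_iff (by positivity), sub_mul, ratioPoly]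
  have h3 : Real.exp B * (y * v) ^ k / (Real.exp B * (y * v) ^ k + (q - 1) * v ^ k) *
      (coupling β * (coupling β + q) * (Real.exp B * (y * v) ^ k + (q - 1) * v ^ k)) =
      coupling β * (coupling β + q) * (Real.exp B * (y * v) ^ k) := by
    field_simp
  rw [h3, mul_pow]
  linear_combination (Real.exp B * (y ^ k * v ^ k)) * h2 - ((q - 1) * v ^ k) * h1

lemma ratioPoly_eq_zero (hβ : 0 < β) (hq : 2 ≤ q) {x : ℝ} (hx : x ∈ Set.Icc (0 : ℝ) 1)
    (hfix : biasedStep k q β B x = x) : ratioPoly k q β B (fieldRatio q β x) = 0 := by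
  obtain ⟨C, hC, h⟩ := biasedStep_sub (k := k) (B := B) hβ hq hx
  rw [hfix, sub_self, eq_comm, neg_eq_zero] at h
  exact (mul_eq_zero.1 h).resolve_left hC.ne'

/-- A biased fixed point strictly between two others is beaten by one of them. -/
lemma functional_lt_max_of_between (hβ : 0 < β) (hk : 2 ≤ k) (hq : 2 ≤ q) {a m c : ℝ}
    (ha : 0 ≤ a) (ham : a < m) (hmc : m < c) (hc : c ≤ 1) (fa : biasedStep k q β B a = a)
    (fm : biasedStep k q β B m = m) (fc : biasedStep k q β B c = c) :
    functional (k + 1) q β B (biased q m) <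
      max (functional (k + 1) q β B (biased q a)) (functional (k + 1) q β B (biased q c)) := by
  have hIa : a ∈ Set.Icc (0 : ℝ) 1 := ⟨ha, by linarith⟩
  have hIm : m ∈ Set.Icc (0 : ℝ) 1 := ⟨by linarith, by linarith⟩
  have hIc : c ∈ Set.Icc (0 : ℝ) 1 := ⟨by linarith, hc⟩
  have hr0 : 0 < fieldRatio q β a :=
    div_pos (favouredField_pos hβ.le ha) (otherField_pos hβ.le hq hIa.2)
  rcases ratioPoly_sign hk q hβ.le B hr0 (fieldRatio_lt hβ hq ha ham hIm.2)
    (fieldRatio_lt hβ hq hIm.1 hmc hc) (ratioPoly_eq_zero hβ hq hIa fa)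
    (ratioPoly_eq_zero hβ hq hIm fm) (ratioPoly_eq_zero hβ hq hIc fc) with hs | hs
  · refine lt_max_of_lt_left ?_
    have hI : ∀ x ∈ Set.Icc a m, x ∈ Set.Icc (0 : ℝ) 1 := fun x hx =>
      ⟨ha.trans hx.1, hx.2.trans hIm.2⟩
    refine strictAntiOn_of_deriv_neg (f := fun s => functional (k + 1) q β B (biased q s))
      (convex_Icc a m) (fun x hx => ?_) (fun x hx => ?_) (Set.left_mem_Icc.2 ham.le)
      (Set.right_mem_Icc.2 ham.le) ham
    · obtain ⟨K, -, hder⟩ := hasDerivAt_functional_biased (k := k) (B := B) hβ hq (hI x hx)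
      exact hder.continuousAt.continuousWithinAt
    · rw [interior_Icc] at hx
      have hx' := hI x ⟨hx.1.le, hx.2.le⟩
      obtain ⟨K, hK, hder⟩ := hasDerivAt_functional_biased (k := k) (B := B) hβ hq hx'
      obtain ⟨C, hC, hstep⟩ := biasedStep_sub (k := k) (B := B) hβ hq hx'
      have := hs _ ⟨fieldRatio_lt hβ hq ha hx.1 hx'.2, fieldRatio_lt hβ hq hx'.1 hx.2 hIm.2⟩
      rw [hder.deriv, hstep]
      exact mul_neg_of_neg_of_pos (neg_neg_of_pos (mul_pos hC this)) hK
  · refine lt_max_of_lt_right ?_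
    have hI : ∀ x ∈ Set.Icc m c, x ∈ Set.Icc (0 : ℝ) 1 := fun x hx =>
      ⟨hIm.1.trans hx.1, hx.2.trans hc⟩
    refine strictMonoOn_of_deriv_pos (f := fun s => functional (k + 1) q β B (biased q s))
      (convex_Icc m c) (fun x hx => ?_) (fun x hx => ?_) (Set.left_mem_Icc.2 hmc.le)
      (Set.right_mem_Icc.2 hmc.le) hmc
    · obtain ⟨K, -, hder⟩ := hasDerivAt_functional_biased (k := k) (B := B) hβ hq (hI x hx)
      exact hder.continuousAt.continuousWithinAt
    · rw [interior_Icc] at hx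
      have hx' := hI x ⟨hx.1.le, hx.2.le⟩
      obtain ⟨K, hK, hder⟩ := hasDerivAt_functional_biased (k := k) (B := B) hβ hq hx'
      obtain ⟨C, hC, hstep⟩ := biasedStep_sub (k := k) (B := B) hβ hq hx'
      have := hs _ ⟨fieldRatio_lt hβ hq hIm.1 hx.1 hx'.2, fieldRatio_lt hβ hq hx'.1 hx.2 hc⟩
      rw [hder.deriv, hstep]
      exact mul_pos (neg_pos.2 (mul_neg_of_pos_of_neg hC this)) hK

end

/-! ### Constant recursions -/

section

variable {k q : ℕ} [NeZero q] {β B : ℝ}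

lemma uniform_mem (q : ℕ) [NeZero q] : uniform q ∈ stdSimplex ℝ (Fin q) :=
  ⟨fun _ => by unfold uniform; positivity, by
    have : (q : ℝ) ≠ 0 := Nat.cast_ne_zero.2 (NeZero.ne q)
    simp [uniform, this]⟩

lemma pointMass_mem (q : ℕ) [NeZero q] : pointMass q ∈ stdSimplex ℝ (Fin q) :=
  single_mem_stdSimplex ℝ (0 : Fin q)

lemma tendsto_iterate_of_const (hβ : 0 ≤ β) {c : Fin q → ℝ}
    (hconst : ∀ h ∈ stdSimplex ℝ (Fin q), bp (k + 1) q β B h = c) {x : Fin q → ℝ}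
    (hx : x ∈ stdSimplex ℝ (Fin q)) :
    Tendsto (fun t : ℕ => (bp (k + 1) q β B)^[t] x) atTop (𝓝 c) := by
  refine tendsto_atTop_of_eventually_const (i₀ := 1) fun t ht => ?_
  obtain ⟨t, rfl⟩ := Nat.exists_eq_add_of_le' ht
  rw [Function.iterate_succ_apply']
  exact hconst _ (Set.MapsTo.iterate (fun h hh => bp_mem hβ hh) t hx)

/-- At infinite temperature or with a single spin, the recursion is constant on the simplex. -/
lemma exists_bp_const (hβ : 0 ≤ β) (hdeg : β = 0 ∨ q = 1) :
    ∃ c ∈ stdSimplex ℝ (Fin q), ∀ h ∈ stdSimplex ℝ (Fin q), bp (k + 1) q β B h = c := by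
  refine ⟨_, bp_mem (k := k) (B := B) hβ (uniform_mem q), fun h hh => ?_⟩
  rcases hdeg with rfl | rfl
  · funext σ
    have hu := uniform_mem q
    simp [bp_apply, bpSum, cavity_of_mem hh, cavity_of_mem hu, coupling]
  · congr 1
    funext σ
    have h1 := hh.2
    have h2 := (uniform_mem 1).2
    rw [Fin.sum_univ_one] at h1 h2
    rw [Subsingleton.elim σ 0, h1, h2]

end

end Potts

/-! ### The Bethe prediction -/

theorem theoremt (d q : ℕ) [NeZero q] (hd : 3 ≤ d) (β B : ℝ) (hβ : 0 ≤ β) (hB : 0 ≤ B) :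
    ∃ hf hm : Fin q → ℝ,
      Tendsto (fun t : ℕ => (Potts.bp d q β B)^[t] (Potts.uniform q)) atTop (𝓝 hf) ∧
      Tendsto (fun t : ℕ => (Potts.bp d q β B)^[t] (Potts.pointMass q)) atTop (𝓝 hm) ∧
      hf ∈ Potts.fixedPts d q β B ∧
      hm ∈ Potts.fixedPts d q β B ∧
      BddAbove (Potts.functional d q β B '' Potts.fixedPts d q β B) ∧
      Potts.prediction d q β B =
        max (Potts.functional d q β B hf) (Potts.functional d q β B hm) ∧
      (0 < B → ∀ h ∈ Potts.fixedPts d q β B, h ≠ hf → h ≠ hm →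
        Potts.functional d q β B h <
          max (Potts.functional d q β B hf) (Potts.functional d q β B hm)) := by
  obtain ⟨k, rfl⟩ : ∃ k, d = k + 1 := ⟨d - 1, by omega⟩
  have hk : 2 ≤ k := by omega
  by_cases hdeg : β = 0 ∨ q = 1
  · obtain ⟨c, hc, hconst⟩ := Potts.exists_bp_const (k := k) (B := B) hβ hdeg
    have hfix : Potts.fixedPts (k + 1) q β B = {c} :=
      Set.eq_singleton_iff_unique_mem.2
        ⟨⟨hc, hconst c hc⟩, fun h hh => hh.2.symm.trans (hconst h hh.1)⟩
    refine ⟨c, c, Potts.tendsto_iterate_of_const hβ hconst (Potts.uniform_mem q),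
      Potts.tendsto_iterate_of_const hβ hconst (Potts.pointMass_mem q), by simp [hfix],
      by simp [hfix], by simp [hfix], ?_, fun _ h hh hne => ?_⟩
    · change sSup (Potts.functional (k + 1) q β B '' Potts.fixedPts (k + 1) q β B) = _
      rw [hfix, Set.image_singleton, csSup_singleton, max_self]
    · rw [hfix] at hh
      exact absurd hh hne
  · push Not at hdeg
    have hβ0 : 0 < β := lt_of_le_of_ne hβ (Ne.symm hdeg.1)
    have hq : 2 ≤ q := by
      have := NeZero.ne q
      omega
    have hqi : (q : ℝ)⁻¹ ≤ 1 := inv_le_one_of_one_le₀ (by exact_mod_cast hq.trans' one_le_two)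
    have hqi0 : 0 ≤ (q : ℝ)⁻¹ := by positivity
    have hsub : Set.Icc (q : ℝ)⁻¹ 1 ⊆ Set.Icc 0 1 := Set.Icc_subset_Icc_left hqi0
    have hmono := (Potts.monotoneOn_biasedStep (k := k) (B := B) hβ hq).mono hsub
    have hcont := (Potts.continuousOn_biasedStep (k := k) (B := B) hβ hq).mono hsub
    have hmaps := Potts.mapsTo_biasedStep (k := k) hβ hB hq
    obtain ⟨a, haI, hfa, hlima, hmina⟩ := Potts.exists_tendsto_iterate_left hqi hmono hcont hmaps
    obtain ⟨c, hcI, hfc, hlimc, hmaxc⟩ := Potts.exists_tendsto_iterate_right hqi hmono hcont hmaps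
    have hfixed : ∀ x ∈ Set.Icc (q : ℝ)⁻¹ 1, Potts.biasedStep k q β B x = x →
        Potts.biased q x ∈ Potts.fixedPts (k + 1) q β B := fun x hx hfx =>
      ⟨Potts.biased_mem hq (hsub hx),
        (Potts.bp_biased hβ hq (hsub hx)).trans (congrArg (Potts.biased q) hfx)⟩
    set Φ := Potts.functional (k + 1) q β B with hΦ
    -- Every maximizer with the largest coordinate at the spin `0` is one of the two limits.
    have hlimits : ∀ h ∈ stdSimplex ℝ (Fin q), IsMaxOn Φ (stdSimplex ℝ (Fin q)) h →
        (∀ σ, h σ ≤ h 0) → h = Potts.biased q a ∨ h = Potts.biased q c := by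
      intro h hh hmax h0
      have hbias := Potts.eq_biased hq hh fun σ τ hσ hτ =>
        Potts.eq_of_isMaxOn hβ0 hk hh hmax h0 hσ hτ
      have hfix := Potts.bp_eq_of_isMaxOn hβ0 hh hmax
      have hxI : h 0 ∈ Set.Icc (q : ℝ)⁻¹ 1 := by
        refine ⟨?_, hh.2 ▸ Finset.single_le_sum (fun σ _ => hh.1 σ) (Finset.mem_univ 0)⟩
        rw [inv_le_iff_one_le_mul₀' (by positivity), ← hh.2]
        simpa using Finset.sum_le_card_nsmul Finset.univ h (h 0) fun σ _ => h0 σ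
      have hfx : Potts.biasedStep k q β B (h 0) = h 0 := by
        rw [Potts.biasedStep, ← hbias, hfix]
      rcases (hmina _ hxI hfx).eq_or_lt with hax | hax
      · exact Or.inl (by rw [hax]; exact hbias)
      rcases (hmaxc _ hxI hfx).eq_or_lt with hxc | hxc
      · exact Or.inr (by rw [← hxc]; exact hbias)
      · have hlt := Potts.functional_lt_max_of_between hβ0 hk hq (hsub haI).1 hax hxc hcI.2 hfa hfx
          hfc
        rw [← hbias] at hlt
        exact absurd (max_le (hmax (Potts.biased_mem hq (hsub haI)))
          (hmax (Potts.biased_mem hq (hsub hcI)))) (not_le.2 hlt)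
    have hbound : ∀ h ∈ stdSimplex ℝ (Fin q),
        Φ h ≤ max (Φ (Potts.biased q a)) (Φ (Potts.biased q c)) := by
      intro h hh
      obtain ⟨g, hg, hgmax, hg0⟩ :=
        Potts.exists_isMaxOn_forall_le (k := k) (q := q) hβ hB
      refine (hgmax hh : Φ h ≤ Φ g).trans ?_
      rcases hlimits g hg hgmax hg0 with rfl | rfl
      exacts [le_max_left _ _, le_max_right _ _]
    have hfa' := hfixed a haI hfa
    have hfc' := hfixed c hcI hfc
    have hbdd : max (Φ (Potts.biased q a)) (Φ (Potts.biased q c)) ∈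
        upperBounds (Φ '' Potts.fixedPts (k + 1) q β B) := by
      rintro _ ⟨h, hh, rfl⟩
      exact hbound h hh.1
    refine ⟨Potts.biased q a, Potts.biased q c, ?_, ?_, hfa', hfc', ⟨_, hbdd⟩, ?_, ?_⟩
    · rw [Potts.uniform_eq_biased hq]
      simp only [Potts.iterate_bp_biased hβ hB hq (Set.left_mem_Icc.2 hqi)]
      exact (Potts.continuous_biased.tendsto a).comp hlima
    · rw [Potts.pointMass_eq_biased]
      simp only [Potts.iterate_bp_biased hβ hB hq (Set.right_mem_Icc.2 hqi)]
      exact (Potts.continuous_biased.tendsto c).comp hlimc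
    · change sSup (Φ '' Potts.fixedPts (k + 1) q β B) = _
      refine IsGreatest.csSup_eq ⟨?_, hbdd⟩
      rcases max_choice (Φ (Potts.biased q a)) (Φ (Potts.biased q c)) with h | h <;> rw [h]
      exacts [⟨_, hfa', rfl⟩, ⟨_, hfc', rfl⟩]
    · intro hBpos h hh hna hnc
      by_contra! hle
      have hmax : IsMaxOn Φ (stdSimplex ℝ (Fin q)) h := isMaxOn_iff.2 fun g hg =>
        (hbound g hg).trans hle
      have h0 : ∀ σ, h σ ≤ h 0 := by
        by_contra! hσ
        obtain ⟨σ, hσ⟩ := hσ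
        -- With a positive field, swapping `0` and `σ` would increase the functional.
        exact absurd (hmax (Potts.comp_mem hh.1 (Equiv.swap 0 σ)))
          (not_le.2 (Potts.functional_lt_comp hβ0 hBpos hh.1 (Equiv.swap 0 σ) (by simpa using hσ)))
      rcases hlimits h hh.1 hmax h0 with h1 | h1
      exacts [hna h1, hnc h1]
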